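/- Let $c\ge 1$ be fixed. An $n\times n$ grayscale image is a map $M:\{1,\dots,n\}^2\to[0,1]$; its elements $p\in\{1,\dots,n\}^2$ are called pixels. An image-affine transformation is a map $T(p)=\lfloor Ap+t\rfloor$ (rounding down in each coordinate), given by a real $2\times2$ matrix $A$ with $\|v\|/c\le\|Av\|\le c\|v\|$ for all $v\in\mathbb R^2$ (Euclidean norm; in particular $A$ is non-singular) and a vector $t\in\mathbb R^2$. For such $T$ let $Out_T$ be the number of pixels $p$ with $T(p)\notin\{1,\dots,n\}^2$, and for images $M_1,M_2$ put $$\Delta_T(M_1,M_2)=\frac1{n^2}\Big[Out_T+\sum_{p:\,T(p)\in\{1,\dots,n\}^2}|M_1(p)-M_2(T(p))|\Big],\qquad \Delta(M_1,M_2)=\min_T\Delta_T(M_1,M_2),$$ the minimum being over all image-affine transformations $T$ (for the given $c$). Consider the following algorithm, with oracle access to $M_1$ and $M_2$, precision parameter $\epsilon$ and sample size $k$. (1) Sample pixels $p_1,\dots,p_k$ and $q_1,\dots,q_k$ independently and uniformly at random (with replacement), and query $M_1(p_i)$ and $M_2(q_j)$ for all $i,j$. (2) Enumerate all image-affine transformations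 $T_1,\dots,T_m$, where transformations that induce the same map on $\{1,\dots,n\}^2$, with all values outside of $\{1,\dots,n\}^2$ identified, need not be distinguished. (3) For each $T_\ell$ let $Hit_\ell$ be the number of index pairs $(i,j)$ with $T_\ell(p_i)=q_j$, and let $Bad_\ell$ be the average of $|M_1(p_i)-M_2(q_j)|$ over these pairs. (4) Among the $T_\ell$ with $Hit_\ell\ge\epsilon$, return one that minimizes $Out_{T_\ell}+(n^2-Out_{T_\ell})\cdot Bad_\ell$. Theorem. There are constants $C>0$ and $a\in\mathbb N$, depending only on $c$, such that for every $n\ge1$, every $\epsilon\in(0,1]$, every such enumeration and all $n\times n$ grayscale images $M_1,M_2$, the algorithm with sample size $k=\big\lceil C\,\frac{n}{\epsilon^2}\,\log^a(n+1)\big\rceil=\tilde\Theta(n/\epsilon^2)$ always makes exactly $2k$ queries, and with probability at least $2/3$ it returns a transformation $T$ with $$|\Delta_T(M_1,M_2)-\Delta(M_1,M_2)|<\epsilon.$$ -/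

import Mathlib

open scoped Matrix

namespace ImageMatching

noncomputable section

/-! ### Images and image-affine transformations -/

/-- The pixel set `{1, …, n}²` of an `n × n` image, inside `ℤ²`. -/
abbrev grid (n : ℕ) : Finset (ℤ × ℤ) := Finset.Icc (1, 1) ((n : ℤ), (n : ℤ))

/-- A pixel of an `n × n` image. -/
abbrev Pixel (n : ℕ) : Type := {p : ℤ × ℤ // p ∈ grid n}

/-- An `n × n` grayscale image: every pixel has a value in `[0, 1]`. -/
abbrev GrayImage (n : ℕ) : Type := Pixel n → unitInterval

instance pixelNonempty (n : ℕ) [NeZero n] : Nonempty (Pixel n) :=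
  ⟨⟨(1, 1), by
    have : 1 ≤ n := NeZero.one_le
    simp only [grid, Finset.mem_Icc, Prod.mk_le_mk]
    omega⟩⟩

/-- An image-affine transformation in matrix format, that is, a matrix `A` and a translation
vector `t`, where `A` has scaling factor in `[1/c, c]` (Euclidean norm). For `0 < c` the lower
bound makes `A` non-singular. -/
structure ImageAffine (c : ℝ) where
  A : Matrix (Fin 2) (Fin 2) ℝ
  t : Fin 2 → ℝ
  scaling : ∀ v : EuclideanSpace ℝ (Fin 2),
    ‖v‖ / c ≤ ‖Matrix.toEuclideanLin A v‖ ∧ ‖Matrix.toEuclideanLin A v‖ ≤ c * ‖v‖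

namespace ImageAffine

variable {c : ℝ}

/-- The map `T(p) = ⌊A p + t⌋`, rounding down in each coordinate. -/
def apply (T : ImageAffine c) (p : ℤ × ℤ) : ℤ × ℤ :=
  let w : Fin 2 → ℝ := T.A *ᵥ ![(p.1 : ℝ), (p.2 : ℝ)] + T.t
  (⌊w 0⌋, ⌊w 1⌋)

/-- The map that `T` induces on the pixels of an `n × n` image; `none` means that the pixel is
mapped out of the image. -/
def pixelMap (n : ℕ) (T : ImageAffine c) (p : Pixel n) : Option (Pixel n) :=
  if h : T.apply p.1 ∈ grid n then some ⟨T.apply p.1, h⟩ else none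

/-- The number of pixels that `T` maps out of the image. -/
def out (n : ℕ) (T : ImageAffine c) : ℕ :=
  (Finset.univ.filter fun p : Pixel n => T.apply p.1 ∉ grid n).card

end ImageAffine

/-- The distance `Δ_T(M₁, M₂)` with respect to the transformation `T`. -/
def distT {c : ℝ} {n : ℕ} (T : ImageAffine c) (M₁ M₂ : GrayImage n) : ℝ :=
  1 / (n : ℝ) ^ 2 * ((T.out n : ℝ) +
    ∑ p : Pixel n, if h : T.apply p.1 ∈ grid n then
      |(M₁ p : ℝ) - (M₂ ⟨T.apply p.1, h⟩ : ℝ)| else 0)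

/-- The distance `Δ(M₁, M₂)`: the minimum of `Δ_T(M₁, M₂)` over all image-affine transformations
with scaling factor in `[1/c, c]` (attained, see `exists_distT_eq_imageDist`). -/
def imageDist (c : ℝ) {n : ℕ} (M₁ M₂ : GrayImage n) : ℝ :=
  ⨅ T : ImageAffine c, distT T M₁ M₂

/-- `L` enumerates all image-affine transformations of `n × n` images: up to the induced action on
the image (targets outside of the image are not distinguished) each of them occurs in `L`. -/
def Enumerates (n : ℕ) {c : ℝ} (L : List (ImageAffine c)) : Prop :=
  ∀ T : ImageAffine c, ∃ T' ∈ L, T'.pixelMap n = T.pixelMap n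

/-! ### Randomized algorithms with oracle access to two images -/

/-- A randomized algorithm with oracle access to two `n × n` images. It can draw a uniformly random
pixel, and it can query the value of a pixel in the first (`false`) or the second (`true`) image. -/
inductive QueryAlg (n : ℕ) (α : Type) : Type
  | ret (a : α) : QueryAlg n α
  | sample (next : Pixel n → QueryAlg n α) : QueryAlg n α
  | query (image : Bool) (p : Pixel n) (next : unitInterval → QueryAlg n α) : QueryAlg n α

namespace QueryAlg

variable {n : ℕ} {α β : Type}

/-- Sequential composition. -/
def bind : QueryAlg n α → (α → QueryAlg n β) → QueryAlg n β
  | ret a, g => g a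
  | sample next, g => sample fun p => (next p).bind g
  | query b p next, g => query b p fun v => (next v).bind g

/-- The joint law of the output and the number of queries made, on the images `M₁`, `M₂`. -/
def run [NeZero n] (M₁ M₂ : GrayImage n) : QueryAlg n α → PMF (α × ℕ)
  | ret a => PMF.pure (a, 0)
  | sample next => (PMF.uniformOfFintype (Pixel n)).bind fun p => run M₁ M₂ (next p)
  | query b p next =>
      (run M₁ M₂ (next (if b then M₂ p else M₁ p))).map fun r => (r.1, r.2 + 1)

/-- Draw `k` independent uniformly random pixels (with replacement) of one of the images, and query
the value of each. -/
def draw (image : Bool) : (k : ℕ) → QueryAlg n (Fin k → Pixel n × unitInterval)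
  | 0 => ret Fin.elim0
  | k + 1 => sample fun p => query image p fun v =>
      (draw image k).bind fun s => ret (Fin.cons (p, v) s)

end QueryAlg

/-! ### The matching algorithm -/

section Algorithm

variable {n k : ℕ} {c : ℝ}

/-- The pairs of indices `(i, j)` of sampled pixels with `T(p_i) = q_j`. -/
def hitPairs (T : ImageAffine c) (P Q : Fin k → Pixel n × unitInterval) : Finset (Fin k × Fin k) :=
  Finset.univ.filter fun x => T.apply (P x.1).1.1 = (Q x.2).1.1

/-- The number `Hit` of sampled pairs `p_i`, `q_j` with `T(p_i) = q_j`. -/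
def hit (T : ImageAffine c) (P Q : Fin k → Pixel n × unitInterval) : ℕ :=
  (hitPairs T P Q).card

/-- The average `Bad` of `|M₁(p_i) - M₂(q_j)|` over the sampled pairs with `T(p_i) = q_j`, computed
from the query answers. -/
def bad (T : ImageAffine c) (P Q : Fin k → Pixel n × unitInterval) : ℝ :=
  1 / (hit T P Q : ℝ) * ∑ x ∈ hitPairs T P Q, |((P x.1).2 : ℝ) - ((Q x.2).2 : ℝ)|

/-- The quantity that the algorithm minimizes: the estimate `Out + (n² - Out) · Bad` of
`n² · Δ_T(M₁, M₂)`. -/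
def score (T : ImageAffine c) (P Q : Fin k → Pixel n × unitInterval) : ℝ :=
  (T.out n : ℝ) + ((n : ℝ) ^ 2 - (T.out n : ℝ)) * bad T P Q

/-- The matching algorithm with precision `ε`, sample size `k` and enumeration `L` of the
image-affine transformations. It returns `none` when all transformations are discarded. -/
def matchAlg (n : ℕ) (ε : ℝ) (k : ℕ) (L : List (ImageAffine c)) :
    QueryAlg n (Option (ImageAffine c)) :=
  (QueryAlg.draw false k).bind fun P =>
    (QueryAlg.draw true k).bind fun Q =>
      QueryAlg.ret
        ((L.filter fun T => decide (ε ≤ (hit T P Q : ℝ))).argmin fun T => score T P Q)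

/-- The sample size `⌈C · (n / ε²) · log(n + 1) ^ a⌉`. -/
def sampleSize (C : ℝ) (a n : ℕ) (ε : ℝ) : ℕ :=
  ⌈C * ((n : ℝ) / ε ^ 2) * Real.log ((n : ℝ) + 1) ^ a⌉₊

end Algorithm

/-! ### The definitions are not vacuous -/

/-- The transformations have finitely many actions on an image, hence an enumeration exists. -/
theorem exists_enumerates (n : ℕ) (c : ℝ) : ∃ L : List (ImageAffine c), Enumerates n L := by
  classical
  have hfin : (Set.range fun T : ImageAffine c => T.pixelMap n).Finite := Set.toFinite _
  obtain ⟨s, hs⟩ := hfin.exists_finset_coe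
  have hs' : ∀ f ∈ s, ∃ T : ImageAffine c, T.pixelMap n = f := by
    intro f hf
    have : f ∈ (s : Set _) := hf
    rw [hs] at this
    exact this
  choose g hg using hs'
  refine ⟨s.attach.toList.map fun f => g f.1 f.2, fun T => ?_⟩
  have hT : T.pixelMap n ∈ s := by
    have : T.pixelMap n ∈ (s : Set _) := by rw [hs]; exact ⟨T, rfl⟩
    exact this
  exact ⟨g _ hT, List.mem_map.2 ⟨⟨_, hT⟩, by simp, rfl⟩, hg _ hT⟩

/-- For `1 ≤ c` the identity is an admissible transformation. -/
theorem nonempty_imageAffine {c : ℝ} (hc : 1 ≤ c) : Nonempty (ImageAffine c) :=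
  ⟨⟨1, 0, fun v => by
    have h : Matrix.toEuclideanLin (1 : Matrix (Fin 2) (Fin 2) ℝ) v = v := by
      simp
    rw [h]
    exact ⟨div_le_self (norm_nonneg v) hc, le_mul_of_one_le_left (norm_nonneg v) hc⟩⟩⟩

theorem distT_eq_of_pixelMap_eq {c : ℝ} {n : ℕ} {T T' : ImageAffine c}
    (h : T.pixelMap n = T'.pixelMap n) (M₁ M₂ : GrayImage n) :
    distT T M₁ M₂ = distT T' M₁ M₂ := by
  have key : ∀ S : ImageAffine c, distT S M₁ M₂ = 1 / (n : ℝ) ^ 2 * ∑ p : Pixel n,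
      (S.pixelMap n p).elim 1 fun q => |(M₁ p : ℝ) - (M₂ q : ℝ)| := by
    intro S
    unfold distT ImageAffine.out
    congr 1
    rw [Finset.card_filter, Nat.cast_sum, ← Finset.sum_add_distrib]
    refine Finset.sum_congr rfl fun p _ => ?_
    unfold ImageAffine.pixelMap
    by_cases hp : S.apply p.1 ∈ grid n
    · simp only [hp, not_true_eq_false, if_false, dif_pos, Nat.cast_zero, zero_add,
        Option.elim_some]
    · simp only [hp, not_false_eq_true, if_true, dif_neg, Nat.cast_one, add_zero,
        Option.elim_none]
  rw [key, key, h]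

/-- The minimum in the definition of the distance is attained. -/
theorem exists_distT_eq_imageDist {c : ℝ} (hc : 1 ≤ c) {n : ℕ} (M₁ M₂ : GrayImage n) :
    ∃ T : ImageAffine c, distT T M₁ M₂ = imageDist c M₁ M₂ := by
  have := nonempty_imageAffine hc
  obtain ⟨L, hL⟩ := exists_enumerates n c
  have hfin : (Set.range fun T : ImageAffine c => distT T M₁ M₂).Finite := by
    refine ((L.map fun T => distT T M₁ M₂).finite_toSet).subset ?_
    rintro _ ⟨T, rfl⟩
    obtain ⟨T', hT', he⟩ := hL T
    exact List.mem_map.2 ⟨T', hT', distT_eq_of_pixelMap_eq he M₁ M₂⟩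
  exact (Set.range_nonempty _).csInf_mem hfin

end

end ImageMatching

namespace ImageMatching

open Finset

/-! ### Concentration for sums of independent uniform samples -/

/-! For a fixed `T`, `Out` is known exactly, so only the total of `|M₁ p - M₂ (T p)|` over the graph
of `T` must be estimated. Both `Hit` and the numerator of `Bad` are sums, over all sampled pairs, of
a weight in `[0, 1]` supported on that graph; each has mean `k² / n⁴` times the total weight of the
graph. It suffices that all these sums lie within `(ε / 5) k² / n²` of their means.

The sampled pairs are not independent, so the sum is handled in two stages
(`exists_card_le_of_pairSum`). The samples `p_i` alone give independent row sums in `[0, 1]`. With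
the `p_i` fixed, the `q_j` give independent terms bounded by `K * M`: `K` bounds the fibres of `T`
(`card_fibre_le`, from the lower scaling bound) and `M` bounds how often one pixel is drawn. These
terms have mean at most `k / n²`, and the Bernstein-type bound `card_deviation_le` exploits this:
the exponent is of order `ε² k² / (K M n²)`, which is why `k` of order `n`, up to `ε` and
logarithms, is enough.

The union bound is affordable because only polynomially many maps are induced on the pixels
(`card_pixelMaps_le`, via Sauer–Shelah for half-spaces). Finally, `outcome_of_pairSum` deduces
near-optimality deterministically; an optimal `T` with too little overlap to be hit is replaced by
the identity. -/

theorem exp_le_one_add_add_sq {x : ℝ} (hx : |x| ≤ 1) : Real.exp x ≤ 1 + x + x ^ 2 := by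
  have := (abs_le.1 (Real.abs_exp_sub_one_sub_id_le hx)).2
  linarith

/-- Exponential moment bound for a sum of `k` independent uniform samples. -/
theorem sum_exp_sum_le {α : Type*} [Fintype α] [Nonempty α] (f : α → ℝ) (k : ℕ) {a b : ℝ}
    (hf : ∀ x, |f x| ≤ 1) (ha : ∑ x, f x ≤ a * Fintype.card α)
    (hb : ∑ x, f x ^ 2 ≤ b * Fintype.card α) :
    ∑ x : Fin k → α, Real.exp (∑ i, f (x i)) ≤
      (Fintype.card (Fin k → α) : ℝ) * Real.exp (k * (a + b)) := by
  have hN : (0 : ℝ) < Fintype.card α := by exact_mod_cast Fintype.card_pos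
  have h1 : ∑ x, Real.exp (f x) ≤ Fintype.card α * Real.exp (a + b) := by
    calc ∑ x, Real.exp (f x) ≤ ∑ x, (1 + f x + f x ^ 2) :=
          sum_le_sum fun x _ => exp_le_one_add_add_sq (hf x)
      _ = Fintype.card α + ∑ x, f x + ∑ x, f x ^ 2 := by
          simp [sum_add_distrib]
      _ ≤ Fintype.card α * (a + b + 1) := by linarith
      _ ≤ _ := by gcongr; exact Real.add_one_le_exp _
  calc ∑ x : Fin k → α, Real.exp (∑ i, f (x i))
      = (∑ x, Real.exp (f x)) ^ k := by
        rw [Fintype.sum_pow]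
        exact sum_congr rfl fun x _ => Real.exp_sum _ _
    _ ≤ (Fintype.card α * Real.exp (a + b)) ^ k := by
        gcongr
    _ = _ := by
        rw [mul_pow, ← Real.exp_nat_mul]
        simp

/-- Bernstein-type tail bound, by counting: among all `k`-tuples, few have a sum `∑ i, f (x i)`
that deviates from `k` times the mean of `f` by at least `t`. -/
theorem card_deviation_le {α : Type*} [Fintype α] [Nonempty α] (f : α → ℝ) (k : ℕ)
    {B m t θ : ℝ} (hB : 0 < B) (hf0 : ∀ x, 0 ≤ f x) (hfB : ∀ x, f x ≤ B)
    (hm : ∑ x, f x ≤ m * Fintype.card α) (hθ0 : 0 ≤ θ) (hθ1 : θ ≤ 1) :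
    ((univ.filter fun x : Fin k → α =>
        t ≤ |∑ i, f (x i) - k * ((∑ x, f x) / Fintype.card α)|).card : ℝ) ≤
      Fintype.card (Fin k → α) * (2 * Real.exp (-(θ * t / B) + θ ^ 2 * (k * m) / B)) := by
  have hN : (0 : ℝ) < Fintype.card α := by exact_mod_cast Fintype.card_pos
  set μ := (∑ x, f x) / Fintype.card α with hμ
  have hμN : μ * Fintype.card α = ∑ x, f x := by rw [hμ]; field_simp
  -- The signs `s = 1` and `s = -1` give the exponential moments for the upper and the lower tail.
  have key : ∀ s : ℝ, |s| = 1 → ∑ x : Fin k → α, Real.exp (∑ i, s * θ / B * f (x i)) ≤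
      (Fintype.card (Fin k → α) : ℝ) * Real.exp (k * (s * θ / B * μ + θ ^ 2 / B * m)) := by
    intro s hs
    have hs2 : s ^ 2 = 1 := by rw [← sq_abs, hs]; norm_num
    refine sum_exp_sum_le (fun x => s * θ / B * f x) k (fun x => ?_) ?_ ?_
    · rw [abs_mul, abs_div, abs_mul, hs, abs_of_pos hB, abs_of_nonneg hθ0, abs_of_nonneg (hf0 x),
        one_mul, div_mul_eq_mul_div, div_le_one hB]
      nlinarith [hf0 x, hfB x]
    · rw [← mul_sum, mul_assoc, hμN]
    -- The second moment is controlled by the mean, since `f ^ 2 ≤ B * f`. This makes the bound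
    -- sensitive to small means.
    · calc ∑ x, (s * θ / B * f x) ^ 2 ≤ ∑ x, θ ^ 2 / B * f x := by
            refine sum_le_sum fun x _ => ?_
            have : (s * θ / B * f x) ^ 2 = θ ^ 2 / B * (f x * (f x / B)) := by
              rw [mul_pow, div_pow, mul_pow, hs2]; field_simp
            rw [this]
            gcongr
            exact mul_le_of_le_one_right (hf0 x) ((div_le_one hB).2 (hfB x))
        _ ≤ _ := by
            rw [← mul_sum, mul_assoc]
            gcongr
  have h1 := key 1 (by simp)
  have h2 := key (-1) (by simp)
  set E := Real.exp (-(θ * t / B) + θ ^ 2 * (k * m) / B)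
  have hpt : ∀ x : Fin k → α, (if t ≤ |∑ i, f (x i) - k * μ| then (1 : ℝ) else 0) ≤
      Real.exp (∑ i, 1 * θ / B * f (x i)) * Real.exp (-(θ * (k * μ) / B) - θ * t / B) +
      Real.exp (∑ i, (-1) * θ / B * f (x i)) * Real.exp (θ * (k * μ) / B - θ * t / B) := by
    intro x
    rw [← mul_sum, ← mul_sum, ← Real.exp_add, ← Real.exp_add]
    set S := ∑ i, f (x i)
    split_ifs with h
    · rcases le_abs.1 h with h | h
      · have : 0 ≤ 1 * θ / B * S + (-(θ * (k * μ) / B) - θ * t / B) := by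
          have : 1 * θ / B * S + (-(θ * (k * μ) / B) - θ * t / B) = θ / B * (S - k * μ - t) := by
            ring
          rw [this]
          exact mul_nonneg (by positivity) (by linarith)
        have := Real.one_le_exp this
        have := Real.exp_pos (-1 * θ / B * S + (θ * (k * μ) / B - θ * t / B))
        linarith
      · have : 0 ≤ (-1) * θ / B * S + (θ * (k * μ) / B - θ * t / B) := by
          have : (-1) * θ / B * S + (θ * (k * μ) / B - θ * t / B) =
              θ / B * (-(S - k * μ) - t) := by
            ring
          rw [this]
          exact mul_nonneg (by positivity) (by linarith)
        have := Real.one_le_exp this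
        have := Real.exp_pos (1 * θ / B * S + (-(θ * (k * μ) / B) - θ * t / B))
        linarith
    · positivity
  calc ((univ.filter fun x : Fin k → α => t ≤ |∑ i, f (x i) - k * μ|).card : ℝ)
      = ∑ x : Fin k → α, if t ≤ |∑ i, f (x i) - k * μ| then (1 : ℝ) else 0 := by
        rw [card_filter]; push_cast; rfl
    _ ≤ _ := sum_le_sum fun x _ => hpt x
    _ = (∑ x : Fin k → α, Real.exp (∑ i, 1 * θ / B * f (x i))) *
          Real.exp (-(θ * (k * μ) / B) - θ * t / B) +
        (∑ x : Fin k → α, Real.exp (∑ i, (-1) * θ / B * f (x i))) *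
          Real.exp (θ * (k * μ) / B - θ * t / B) := by
        rw [sum_add_distrib, sum_mul, sum_mul]
    _ ≤ (Fintype.card (Fin k → α) * Real.exp (k * (1 * θ / B * μ + θ ^ 2 / B * m))) *
          Real.exp (-(θ * (k * μ) / B) - θ * t / B) +
        (Fintype.card (Fin k → α) * Real.exp (k * ((-1) * θ / B * μ + θ ^ 2 / B * m))) *
          Real.exp (θ * (k * μ) / B - θ * t / B) := by
        gcongr
    _ = Fintype.card (Fin k → α) * (2 * E) := by
        rw [mul_assoc, mul_assoc, ← Real.exp_add, ← Real.exp_add]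
        have e1 : k * (1 * θ / B * μ + θ ^ 2 / B * m) + (-(θ * (k * μ) / B) - θ * t / B) =
            -(θ * t / B) + θ ^ 2 * (k * m) / B := by ring
        have e2 : k * ((-1) * θ / B * μ + θ ^ 2 / B * m) + (θ * (k * μ) / B - θ * t / B) =
            -(θ * t / B) + θ ^ 2 * (k * m) / B := by ring
        rw [e1, e2]
        ring

/-! ### Counting half-spaces -/

/-- The traces of linear half-spaces of `ℝ^d` on a family of vectors. -/
noncomputable def halfSpaceTraces {α : Type*} [Fintype α] {d : ℕ} (φ : α → Fin d → ℝ) :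
    Finset (Finset α) := by
  classical
  exact univ.filter fun s => ∃ v : Fin d → ℝ, ∀ x, x ∈ s ↔ 0 ≤ v ⬝ᵥ φ x

theorem mem_halfSpaceTraces {α : Type*} [Fintype α] {d : ℕ} {φ : α → Fin d → ℝ} {s : Finset α} :
    s ∈ halfSpaceTraces φ ↔ ∃ v : Fin d → ℝ, ∀ x, x ∈ s ↔ 0 ≤ v ⬝ᵥ φ x := by
  simp [halfSpaceTraces]

/-- Half-spaces through the origin of `ℝ^d` shatter at most `d` vectors. -/
theorem card_le_of_shatters_halfSpaceTraces {α : Type*} [Fintype α] [DecidableEq α] {d : ℕ}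
    {φ : α → Fin d → ℝ} {s : Finset α} (hs : (halfSpaceTraces φ).Shatters s) : s.card ≤ d := by
  by_contra! hd
  have hdep : ¬ LinearIndependent ℝ fun x : s => φ x := by
    intro h
    have := h.fintype_card_le_finrank
    simp at this
    omega
  rw [Fintype.not_linearIndependent_iff] at hdep
  obtain ⟨g, hg, i, hi⟩ := hdep
  obtain ⟨g, hg, i, hi⟩ : ∃ g : s → ℝ, ∑ x, g x • φ x = 0 ∧ ∃ i, g i < 0 := by
    rcases lt_or_gt_of_ne hi with h | h
    · exact ⟨g, hg, i, h⟩
    · exact ⟨-g, by simpa [sum_neg_distrib] using hg, i, by simpa using h⟩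
  -- A half-space cutting out exactly `{g ≥ 0}` gives `v ⬝ᵥ φ x` a sign matching that of `g x`, so
  -- no term of the dependence paired with `v` is negative. Terms with `g x ≥ 0` may vanish; the
  -- term with `g i < 0` is strictly positive, which is why a negative coefficient was arranged.
  obtain ⟨u, hu, hsu⟩ := hs (t := (univ.filter fun x : s => 0 ≤ g x).map
    (Function.Embedding.subtype _)) (by intro x; simp; tauto)
  obtain ⟨v, hv⟩ := mem_halfSpaceTraces.1 hu
  have hiff : ∀ x : s, 0 ≤ v ⬝ᵥ φ x ↔ 0 ≤ g x := by
    intro x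
    rw [← hv]
    have : (x : α) ∈ s ∩ u ↔ (x : α) ∈ (univ.filter fun x : s => 0 ≤ g x).map
      (Function.Embedding.subtype _) := by rw [hsu]
    simpa using this
  have h0 : ∑ x : s, g x * (v ⬝ᵥ φ x) = 0 := by
    have := congrArg (fun w => v ⬝ᵥ w) hg
    simpa [dotProduct_sum, dotProduct_smul] using this
  have hpos : 0 < ∑ x : s, g x * (v ⬝ᵥ φ x) := by
    refine sum_pos' (fun x _ => ?_) ⟨i, mem_univ _, ?_⟩
    · rcases le_or_gt 0 (g x) with h | h
      · exact mul_nonneg h ((hiff x).2 h)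
      · exact (mul_pos_of_neg_of_neg h (not_le.1 fun h' => not_le.2 h ((hiff x).1 h'))).le
    · exact mul_pos_of_neg_of_neg hi (not_le.1 fun h' => not_le.2 hi ((hiff i).1 h'))
  exact hpos.ne' h0

/-- Sauer–Shelah with VC dimension at most `d`. The sum of binomials is compared termwise with the
expansion of `(N + 1) ^ d`, using `N.choose k ≤ N ^ k`. -/
theorem card_halfSpaceTraces_le {α : Type*} [Fintype α] {d : ℕ} (φ : α → Fin d → ℝ) :
    (halfSpaceTraces φ).card ≤ (Fintype.card α + 1) ^ d := by
  classical
  have hvc : (halfSpaceTraces φ).vcDim ≤ d :=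
    Finset.sup_le fun s hs => card_le_of_shatters_halfSpaceTraces (mem_shatterer.1 hs)
  calc (halfSpaceTraces φ).card ≤ (halfSpaceTraces φ).shatterer.card := card_le_card_shatterer _
    _ ≤ ∑ k ∈ Iic (halfSpaceTraces φ).vcDim, (Fintype.card α).choose k :=
        card_shatterer_le_sum_vcDim
    _ ≤ ∑ k ∈ range (d + 1), (Fintype.card α).choose k := by
        refine sum_le_sum_of_subset fun k hk => ?_
        simp only [mem_Iic, mem_range] at hk ⊢
        omega
    _ ≤ ∑ k ∈ range (d + 1), Fintype.card α ^ k * 1 ^ (d - k) * d.choose k := by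
        refine sum_le_sum fun k hk => ?_
        have : 0 < d.choose k := Nat.choose_pos (by simpa [Nat.lt_succ_iff] using hk)
        calc (Fintype.card α).choose k ≤ Fintype.card α ^ k := Nat.choose_le_pow _ _
          _ ≤ _ := by rw [one_pow, mul_one]; exact Nat.le_mul_of_pos_right _ this
    _ = _ := (add_pow _ _ _).symm

/-! ### The law of the algorithm -/

theorem map_uniformOfFintype_equiv {α β : Type*} [Fintype α] [Nonempty α] [Fintype β] [Nonempty β]
    (e : α ≃ β) : (PMF.uniformOfFintype α).map e = PMF.uniformOfFintype β := by
  classical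
  ext b
  rw [PMF.map_apply, tsum_eq_single (e.symm b)]
  · simp [Fintype.card_congr e]
  · intro a ha
    rw [if_neg]
    rintro rfl
    simp at ha

theorem uniformOfFintype_bind_prod {α β γ : Type*} [Fintype α] [Nonempty α] [Fintype β]
    [Nonempty β] (g : α × β → PMF γ) :
    ((PMF.uniformOfFintype α).bind fun a => (PMF.uniformOfFintype β).bind fun b => g (a, b)) =
      (PMF.uniformOfFintype (α × β)).bind g := by
  ext c
  simp only [PMF.bind_apply, PMF.uniformOfFintype_apply, tsum_fintype, Fintype.sum_prod_type,
    Fintype.card_prod, Nat.cast_mul, Finset.mul_sum]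
  rw [ENNReal.mul_inv (by simp) (by simp)]
  simp only [mul_assoc]

namespace QueryAlg

variable {n : ℕ} {α β γ : Type}

theorem bind_bind (x : QueryAlg n α) (f : α → QueryAlg n β) (g : β → QueryAlg n γ) :
    (x.bind f).bind g = x.bind fun a => (f a).bind g := by
  induction x with
  | ret a => rfl
  | sample next ih => simp only [bind, ih]
  | query b p next ih => simp only [bind, ih]

/-- Drawing `k` pixels and continuing with `g` amounts to a uniformly random `k`-tuple of pixels,
at the cost of `k` queries. -/
theorem run_draw_bind [NeZero n] (M₁ M₂ : GrayImage n) (b : Bool) (k : ℕ)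
    (g : (Fin k → Pixel n × unitInterval) → QueryAlg n α) :
    run M₁ M₂ ((draw b k).bind g) =
      (PMF.uniformOfFintype (Fin k → Pixel n)).bind fun x =>
        (run M₁ M₂ (g fun i => (x i, if b then M₂ (x i) else M₁ (x i)))).map
          fun r => (r.1, r.2 + k) := by
  induction k with
  | zero =>
    have : PMF.uniformOfFintype (Fin 0 → Pixel n) = PMF.pure Fin.elim0 := by
      ext x
      rw [Subsingleton.elim x Fin.elim0]
      simp
    rw [this, PMF.pure_bind]
    simp only [draw, bind, add_zero, Prod.mk.eta]
    have h2 : (fun i : Fin 0 => ((Fin.elim0 i : Pixel n), if b then M₂ (Fin.elim0 i) else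
      M₁ (Fin.elim0 i))) = Fin.elim0 := Subsingleton.elim _ _
    rw [h2]
    exact (PMF.map_id _).symm
  | succ k ih =>
    have h3 : PMF.uniformOfFintype (Fin (k + 1) → Pixel n) =
        (PMF.uniformOfFintype (Pixel n × (Fin k → Pixel n))).map
          (Fin.consEquiv fun _ : Fin (k + 1) => Pixel n) :=
      (map_uniformOfFintype_equiv _).symm
    rw [h3, PMF.bind_map, ← uniformOfFintype_bind_prod]
    simp only [draw, bind, run, bind_bind, ih, PMF.map_bind, PMF.map_comp, Function.comp_def]
    congr 1
    ext1 p
    congr 1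
    ext1 x
    have : (Fin.cons (p, if b = true then M₂ p else M₁ p)
        fun i => (x i, if b = true then M₂ (x i) else M₁ (x i)) :
          Fin (k + 1) → Pixel n × unitInterval) =
        fun i => ((Fin.cons p x : Fin (k + 1) → Pixel n) i,
          if b then M₂ ((Fin.cons p x : Fin (k + 1) → Pixel n) i)
          else M₁ ((Fin.cons p x : Fin (k + 1) → Pixel n) i)) := by
      ext1 i
      refine Fin.cases ?_ (fun i => ?_) i <;> simp
    rw [this]
    simp only [Fin.consEquiv, Equiv.coe_fn_mk, add_assoc]

end QueryAlg

variable {n : ℕ} {c : ℝ}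

/-- The output of the algorithm when the sampled pixels are `x` and `y`. -/
noncomputable def outcome (ε : ℝ) (k : ℕ) (L : List (ImageAffine c)) (M₁ M₂ : GrayImage n)
    (z : (Fin k → Pixel n) × (Fin k → Pixel n)) : Option (ImageAffine c) :=
  (L.filter fun T => decide (ε ≤ (hit T (fun i => (z.1 i, M₁ (z.1 i)))
    fun i => (z.2 i, M₂ (z.2 i)) : ℝ))).argmin
      fun T => score T (fun i => (z.1 i, M₁ (z.1 i))) fun i => (z.2 i, M₂ (z.2 i))

/-- All randomness sits in one uniform pair of tuples and the query count is constant, so the rest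
is a counting problem. -/
theorem run_matchAlg [NeZero n] (ε : ℝ) (k : ℕ) (L : List (ImageAffine c)) (M₁ M₂ : GrayImage n) :
    (matchAlg n ε k L).run M₁ M₂ =
      (PMF.uniformOfFintype ((Fin k → Pixel n) × (Fin k → Pixel n))).map
        fun z => (outcome ε k L M₁ M₂ z, 2 * k) := by
  unfold matchAlg
  rw [QueryAlg.run_draw_bind]
  simp only [QueryAlg.run_draw_bind, PMF.map_bind, QueryAlg.run, PMF.pure_map]
  rw [← PMF.bind_pure_comp, ← uniformOfFintype_bind_prod]
  simp [outcome, two_mul]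

theorem le_toOuterMeasure_of_card_le {α β : Type} [Fintype α] [Nonempty α] (f : α → β) (S : Set β)
    (Bad : Finset α) (hBad : ∀ a ∉ Bad, f a ∈ S)
    (hcard : (Bad.card : ℝ) ≤ 1 / 3 * Fintype.card α) :
    (2 / 3 : ENNReal) ≤ ((PMF.uniformOfFintype α).map f).toOuterMeasure S := by
  classical
  rw [PMF.toOuterMeasure_map_apply, PMF.toOuterMeasure_uniformOfFintype_apply]
  have h0 : (Fintype.card α : ENNReal) ≠ 0 := by simp
  rw [ENNReal.le_div_iff_mul_le (Or.inl h0) (Or.inl (by simp))]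
  have h1 : Badᶜ.card ≤ Fintype.card (f ⁻¹' S) := by
    rw [← Fintype.card_coe]
    refine Fintype.card_le_of_injective
      (fun a => ⟨a.1, hBad a.1 (Finset.mem_compl.1 a.2)⟩) fun a b h => ?_
    exact Subtype.ext (congrArg (fun s : f ⁻¹' S => s.1) h)
  have h2 : Bad.card + Badᶜ.card = Fintype.card α := Finset.card_add_card_compl _
  have h3 : 2 * Fintype.card α ≤ 3 * Badᶜ.card := by
    have h4 : 3 * Bad.card ≤ Fintype.card α := by
      have : (3 * Bad.card : ℝ) ≤ Fintype.card α := by linarith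
      exact_mod_cast this
    omega
  have h5 : 2 * Fintype.card α ≤ Fintype.card (f ⁻¹' S) * 3 := by omega
  rw [mul_comm, ← mul_div_assoc, mul_comm]
  exact ENNReal.div_le_of_le_mul (by exact_mod_cast h5)

/-! ### The maps induced on the pixels -/

section PixelMaps

variable {c : ℝ} {n : ℕ}

theorem pixelMap_eq_some_iff (T : ImageAffine c) (p q : Pixel n) :
    T.pixelMap n p = some q ↔ T.apply p.1 = q.1 := by
  unfold ImageAffine.pixelMap
  split_ifs with h
  · rw [Option.some_inj, Subtype.ext_iff]
  · simp only [false_iff]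
    intro h'
    exact h (h' ▸ q.2)

/-- The real coordinate `(A p + t) i`. -/
noncomputable def ImageAffine.coord (T : ImageAffine c) (i : Fin 2) (p : ℤ × ℤ) : ℝ :=
  T.A i 0 * p.1 + T.A i 1 * p.2 + T.t i

theorem ImageAffine.apply_eq (T : ImageAffine c) (p : ℤ × ℤ) :
    T.apply p = (⌊T.coord 0 p⌋, ⌊T.coord 1 p⌋) := by
  simp [ImageAffine.apply, ImageAffine.coord]

/-- A pixel and a threshold, as a vector on which a coordinate of a transformation acts linearly. -/
noncomputable def thresholdVector (x : Pixel n × Fin (n + 1)) : Fin 4 → ℝ :=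
  ![(x.1.1.1 : ℝ), (x.1.1.2 : ℝ), 1, -((x.2 : ℕ) + 1 : ℝ)]

/-- The pixels and thresholds for which the `i`-th coordinate reaches the threshold. -/
noncomputable def ImageAffine.trace (n : ℕ) (T : ImageAffine c) (i : Fin 2) :
    Finset (Pixel n × Fin (n + 1)) := by
  classical
  exact univ.filter fun x => ((x.2 : ℕ) + 1 : ℝ) ≤ T.coord i x.1.1

theorem ImageAffine.mem_trace {T : ImageAffine c} {i : Fin 2} {x : Pixel n × Fin (n + 1)} :
    x ∈ T.trace n i ↔ (((x.2 : ℕ) : ℤ) + 1 : ℤ) ≤ ⌊T.coord i x.1.1⌋ := by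
  rw [Int.le_floor]
  simp [ImageAffine.trace]

theorem ImageAffine.trace_mem (T : ImageAffine c) (i : Fin 2) :
    T.trace n i ∈ halfSpaceTraces (thresholdVector (n := n)) := by
  refine mem_halfSpaceTraces.2 ⟨![T.A i 0, T.A i 1, T.t i, 1], fun x => ?_⟩
  rw [ImageAffine.trace, mem_filter_univ]
  simp only [thresholdVector, ImageAffine.coord,
    dotProduct, Fin.sum_univ_four, Matrix.cons_val]
  constructor <;> intro h <;> linarith

theorem ImageAffine.floor_eq_of_trace_eq {T T' : ImageAffine c} {i : Fin 2}
    (h : T.trace n i = T'.trace n i) (p : Pixel n) (h1 : 1 ≤ ⌊T.coord i p.1⌋)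
    (h2 : ⌊T.coord i p.1⌋ ≤ n) : ⌊T.coord i p.1⌋ = ⌊T'.coord i p.1⌋ := by
  obtain ⟨m, hm⟩ := Int.eq_ofNat_of_zero_le (by omega : 0 ≤ ⌊T.coord i p.1⌋ - 1)
  have key : ∀ j : Fin (n + 1), (((j : ℕ) : ℤ) + 1 : ℤ) ≤ ⌊T.coord i p.1⌋ ↔
      (((j : ℕ) : ℤ) + 1 : ℤ) ≤ ⌊T'.coord i p.1⌋ := fun j => by
    have := ImageAffine.mem_trace (T := T) (i := i) (x := (p, j))
    rw [h, ImageAffine.mem_trace] at this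
    exact this.symm
  -- The thresholds `m + 1` and `m + 2` are the floor and its successor. As the floor can equal `n`,
  -- threshold `n + 1` is needed, hence `Fin (n + 1)`.
  have k1 := key ⟨m, by omega⟩
  have k2 := key ⟨m + 1, by omega⟩
  push_cast at k1 k2
  omega

theorem mem_grid_iff {q : ℤ × ℤ} : q ∈ grid n ↔ 1 ≤ q.1 ∧ q.1 ≤ n ∧ 1 ≤ q.2 ∧ q.2 ≤ n := by
  simp only [mem_Icc, Prod.le_def]
  tauto

theorem ImageAffine.pixelMap_eq_of_trace_eq {T T' : ImageAffine c}
    (h : ∀ i, T.trace n i = T'.trace n i) : T.pixelMap n = T'.pixelMap n := by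
  have key : ∀ {S S' : ImageAffine c}, (∀ i, S.trace n i = S'.trace n i) → ∀ p q : Pixel n,
      S.pixelMap n p = some q → S'.pixelMap n p = some q := by
    intro S S' hS p q hp
    rw [pixelMap_eq_some_iff] at hp ⊢
    rw [← hp]
    have hq := mem_grid_iff.1 (hp ▸ q.2 : S.apply p.1 ∈ grid n)
    rw [S.apply_eq] at hq ⊢
    rw [S'.apply_eq, ← ImageAffine.floor_eq_of_trace_eq (hS 0) p hq.1 hq.2.1,
      ← ImageAffine.floor_eq_of_trace_eq (hS 1) p hq.2.2.1 hq.2.2.2]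
  ext p q
  exact ⟨key h p q, key (fun i => (h i).symm) p q⟩

/-- The maps on the pixels that image-affine transformations induce. -/
noncomputable def pixelMaps (n : ℕ) (c : ℝ) : Finset (Pixel n → Option (Pixel n)) := by
  classical
  exact univ.filter fun φ => ∃ T : ImageAffine c, T.pixelMap n = φ

theorem mem_pixelMaps {φ : Pixel n → Option (Pixel n)} :
    φ ∈ pixelMaps n c ↔ ∃ T : ImageAffine c, T.pixelMap n = φ := by
  simp [pixelMaps]

theorem card_pixel (n : ℕ) : Fintype.card (Pixel n) = n ^ 2 := by
  rw [Fintype.card_coe, grid, Finset.card_Icc_prod]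
  simp [sq]

/-- A pixel map is determined by two half-space traces in `ℝ⁴`, one per coordinate, on `n² (n + 1)`
vectors. Since `n² (n + 1) + 1 ≤ (n + 1) ^ 3`, the exponent is `2 * 4 * 3 = 24`. -/
theorem card_pixelMaps_le (n : ℕ) (c : ℝ) : (pixelMaps n c).card ≤ (n + 1) ^ 24 := by
  rcases isEmpty_or_nonempty (ImageAffine c) with hc | hc
  · have : pixelMaps n c = ∅ := eq_empty_of_forall_notMem fun φ hφ =>
      (mem_pixelMaps.1 hφ).elim fun T _ => hc.elim T
    simp [this]
  choose! S hS using fun φ (h : φ ∈ pixelMaps n c) => mem_pixelMaps.1 h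
  set H := halfSpaceTraces (thresholdVector (n := n))
  have hH : H.card ≤ (n + 1) ^ 12 := by
    refine (card_halfSpaceTraces_le _).trans ?_
    rw [show 12 = 3 * 4 by rfl, pow_mul]
    gcongr
    rw [Fintype.card_prod, card_pixel, Fintype.card_fin]
    nlinarith
  calc (pixelMaps n c).card ≤ (H ×ˢ H).card := by
        refine card_le_card_of_injOn (fun φ => ((S φ).trace n 0, (S φ).trace n 1))
          (fun φ _ => by simp [H, ImageAffine.trace_mem]) fun φ hφ ψ hψ h => ?_
        simp only [Prod.mk.injEq] at h
        rw [← hS φ hφ, ← hS ψ hψ]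
        exact ImageAffine.pixelMap_eq_of_trace_eq (Fin.forall_fin_two.2 h)
    _ ≤ (n + 1) ^ 12 * (n + 1) ^ 12 := by rw [card_product]; gcongr
    _ = (n + 1) ^ 24 := by ring

/-- A bound for the number of pixels with the same image. -/
noncomputable def fibreBound (c : ℝ) : ℕ := (2 * ⌈2 * c⌉₊ + 1) ^ 2

/-- Equal floors force both coordinates of `A (p - q)` below `1` in absolute value, so its norm is
at most `2`; the lower scaling bound then limits `p - q`. -/
theorem ImageAffine.norm_sub_le_of_apply_eq (hc : 0 < c) (T : ImageAffine c) {p q : ℤ × ℤ}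
    (h : T.apply p = T.apply q) :
    |((p.1 - q.1 : ℤ) : ℝ)| ≤ 2 * c ∧ |((p.2 - q.2 : ℤ) : ℝ)| ≤ 2 * c := by
  set u : Fin 2 → ℝ := ![((p.1 - q.1 : ℤ) : ℝ), ((p.2 - q.2 : ℤ) : ℝ)] with hu
  have hcoord : ∀ i, (T.A *ᵥ u) i = T.coord i p - T.coord i q := by
    intro i
    simp [hu, ImageAffine.coord, Matrix.mulVec, dotProduct, Fin.sum_univ_two]
    ring
  rw [T.apply_eq, T.apply_eq, Prod.mk.injEq] at h
  have h0 := Int.abs_sub_lt_one_of_floor_eq_floor h.1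
  have h1 := Int.abs_sub_lt_one_of_floor_eq_floor h.2
  rw [← hcoord] at h0 h1
  have hs := (T.scaling (WithLp.toLp 2 u)).1
  have hA : ‖Matrix.toEuclideanLin T.A (WithLp.toLp 2 u)‖ ≤ 2 := by
    rw [EuclideanSpace.norm_eq]
    refine Real.sqrt_le_iff.2 ⟨by norm_num, ?_⟩
    simp only [Fin.sum_univ_two, Real.norm_eq_abs]
    change |(T.A *ᵥ u) 0| ^ 2 + |(T.A *ᵥ u) 1| ^ 2 ≤ 2 ^ 2
    nlinarith [abs_nonneg ((T.A *ᵥ u) 0), abs_nonneg ((T.A *ᵥ u) 1)]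
  have hn : ‖(WithLp.toLp 2 u : EuclideanSpace ℝ (Fin 2))‖ ≤ 2 * c := by
    rw [div_le_iff₀ hc] at hs
    nlinarith
  exact ⟨(PiLp.norm_apply_le (WithLp.toLp 2 u : EuclideanSpace ℝ (Fin 2)) 0).trans hn,
    (PiLp.norm_apply_le (WithLp.toLp 2 u : EuclideanSpace ℝ (Fin 2)) 1).trans hn⟩

theorem card_fibre_le (hc : 0 < c) (T : ImageAffine c) (q : Pixel n) :
    (univ.filter fun p => T.pixelMap n p = some q).card ≤ fibreBound c := by
  rcases (univ.filter fun p => T.pixelMap n p = some q).eq_empty_or_nonempty with h | ⟨p₀, hp₀⟩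
  · rw [h]; simp
  · simp only [mem_filter, mem_univ, true_and, pixelMap_eq_some_iff] at hp₀
    set m : ℤ := (⌈2 * c⌉₊ : ℤ) with hm
    have hle : ∀ z : ℤ, |(z : ℝ)| ≤ 2 * c → -m ≤ z ∧ z ≤ m := by
      intro z hz
      have : |(z : ℝ)| ≤ (m : ℝ) := hz.trans (by rw [hm]; exact_mod_cast Nat.le_ceil _)
      rw [← abs_le]
      exact_mod_cast this
    calc _ ≤ (Icc ((-m, -m) : ℤ × ℤ) (m, m)).card := by
          refine card_le_card_of_injOn (fun p => p.1 - p₀.1) (fun p hp => ?_) fun a _ b _ h => ?_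
          · simp only [coe_filter, mem_univ, true_and, Set.mem_ofPred_eq,
              pixelMap_eq_some_iff] at hp
            have := T.norm_sub_le_of_apply_eq hc (hp.trans hp₀.symm)
            simp only [coe_Icc, Set.mem_Icc, Prod.le_def, Prod.fst_sub, Prod.snd_sub]
            have h1 := hle _ this.1
            have h2 := hle _ this.2
            tauto
          · exact Subtype.ext (sub_left_injective h)
      _ = fibreBound c := by
          rw [Finset.card_Icc_prod, fibreBound, Int.card_Icc, sq]
          congr <;> omega

end PixelMaps

/-! ### Concentration for pairs of samples -/

section Pairs

variable {α : Type*} [DecidableEq α]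

/-- The weight `g p q` on the graph of the partial map `φ`. -/
def graphWeight (φ : α → Option α) (g : α → α → ℝ) (p q : α) : ℝ :=
  if φ p = some q then g p q else 0

variable {φ : α → Option α} {g : α → α → ℝ} {k : ℕ}

theorem graphWeight_nonneg (hg : ∀ p q, 0 ≤ g p q) (p q : α) : 0 ≤ graphWeight φ g p q := by
  unfold graphWeight
  split_ifs
  exacts [hg p q, le_rfl]

variable [Fintype α]

theorem sum_graphWeight_le_one (hg : ∀ p q, g p q ≤ 1) (p : α) :
    ∑ q, graphWeight φ g p q ≤ 1 := by
  unfold graphWeight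
  rcases h : φ p with _ | r
  · simp
  · simp [hg]

theorem card_filter_map_eq_le {K : ℕ} {M : ℝ} {x : Fin k → α} {q : α}
    (hK : (univ.filter fun p => φ p = some q).card ≤ K) (hM0 : 0 ≤ M)
    (hM : ∀ p, ((univ.filter fun i => x i = p).card : ℝ) ≤ M) :
    ((univ.filter fun i => φ (x i) = some q).card : ℝ) ≤ K * M := by
  rw [card_eq_sum_card_fiberwise (f := x) (t := univ.filter fun p => φ p = some q)
    (fun i hi => by simpa using hi)]
  push_cast
  calc _ ≤ ∑ p ∈ univ.filter (fun p => φ p = some q), M := by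
        refine sum_le_sum fun p _ => (Nat.cast_le.2 (card_le_card ?_)).trans (hM p)
        exact filter_subset_filter _ (filter_subset _ _)
    _ ≤ K * M := by
        rw [sum_const, nsmul_eq_mul]
        gcongr

theorem sum_graphWeight_le {K : ℕ} {M : ℝ} {x : Fin k → α} (hg : ∀ p q, g p q ≤ 1) {q : α}
    (hK : (univ.filter fun p => φ p = some q).card ≤ K) (hM0 : 0 ≤ M)
    (hM : ∀ p, ((univ.filter fun i => x i = p).card : ℝ) ≤ M) :
    ∑ i, graphWeight φ g (x i) q ≤ K * M := by
  refine le_trans ?_ (card_filter_map_eq_le hK hM0 hM)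
  rw [card_filter]
  push_cast
  refine sum_le_sum fun i _ => ?_
  unfold graphWeight
  split_ifs
  exacts [hg _ _, le_rfl]

/-- The total weight of the sampled pairs. -/
def pairSum (φ : α → Option α) (g : α → α → ℝ) (x y : Fin k → α) : ℝ :=
  ∑ j, ∑ i, graphWeight φ g (x i) (y j)

/-- The total weight of the graph. -/
def graphSum (φ : α → Option α) (g : α → α → ℝ) : ℝ :=
  ∑ p, ∑ q, graphWeight φ g p q

/-- The two stages joined by the triangle inequality: given `x`, the mean over `y` is `k / D` times
the sum of row weights, whose own deviation is below `t₁`. -/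
theorem abs_pairSum_sub_lt {D t₁ t₂ : ℝ} (hD : 0 < D) {x y : Fin k → α}
    (h1 : |∑ i, ∑ q, graphWeight φ g (x i) q - k * (graphSum φ g / D)| < t₁)
    (h2 : |pairSum φ g x y - k * ((∑ q, ∑ i, graphWeight φ g (x i) q) / D)| < t₂) :
    |pairSum φ g x y - k ^ 2 * graphSum φ g / D ^ 2| < k * t₁ / D + t₂ := by
  rw [sum_comm] at h2
  set H := ∑ i, ∑ q, graphWeight φ g (x i) q
  have e : pairSum φ g x y - k ^ 2 * graphSum φ g / D ^ 2 =
      (k / D) * (H - k * (graphSum φ g / D)) + (pairSum φ g x y - k * (H / D)) := by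
    field_simp
    ring
  rw [e]
  refine (abs_add_le _ _).trans_lt (add_lt_add_of_le_of_lt ?_ h2)
  rw [abs_mul, abs_of_nonneg (by positivity), mul_div_right_comm]
  gcongr

theorem card_filter_prod_le {β γ : Type*} [Fintype β] [Fintype γ] (P : β → γ → Prop)
    [∀ x, DecidablePred (P x)] {r : ℝ}
    (h : ∀ x, ((univ.filter fun y => P x y).card : ℝ) ≤ r) :
    ((univ.filter fun z : β × γ => P z.1 z.2).card : ℝ) ≤ Fintype.card β * r := by
  rw [card_filter, Fintype.sum_prod_type]
  push_cast
  calc _ ≤ ∑ x : β, r := sum_le_sum fun x _ => by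
        have := h x
        rw [card_filter] at this
        push_cast at this
        exact this
    _ = _ := by simp

theorem card_filter_fst_le {β γ : Type*} [Fintype β] [Fintype γ] (P : β → Prop)
    [DecidablePred P] {r : ℝ} (h : ((univ.filter P).card : ℝ) ≤ Fintype.card β * r) :
    ((univ.filter fun z : β × γ => P z.1).card : ℝ) ≤ Fintype.card (β × γ) * r := by
  have : (univ.filter fun z : β × γ => P z.1) = (univ.filter P) ×ˢ (univ : Finset γ) := by
    ext z; simp
  rw [this, card_product, Fintype.card_prod, card_univ]
  push_cast
  nlinarith [(Nat.cast_nonneg (Fintype.card γ) : (0 : ℝ) ≤ _)]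

/-- For most pairs of `k`-tuples the weight of the sampled pairs is close to its mean,
simultaneously for a finite family of weighted partial maps with small fibres. -/
theorem exists_card_le_of_pairSum [Nonempty α] {ι : Type*} [Fintype ι] (Φ : ι → α → Option α)
    (G : ι → α → α → ℝ) (hG0 : ∀ l p q, 0 ≤ G l p q) (hG1 : ∀ l p q, G l p q ≤ 1) {K : ℕ}
    (hK0 : 0 < K) (hK : ∀ l q, (univ.filter fun p => Φ l p = some q).card ≤ K) (k : ℕ)
    {η L D M : ℝ} (hη0 : 0 < η) (hη1 : η ≤ 1) (hL : 0 < L) (hD : D = Fintype.card α)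
    (hM : M = 2 * k / D + L) :
    ∃ Bad : Finset ((Fin k → α) × (Fin k → α)),
      (∀ z ∉ Bad, ∀ l, |pairSum (Φ l) (G l) z.1 z.2 - k ^ 2 * graphSum (Φ l) (G l) / D ^ 2| <
        η * k ^ 2 / D) ∧
      (Bad.card : ℝ) ≤ Fintype.card ((Fin k → α) × (Fin k → α)) *
        (D * (2 * Real.exp (-L)) + Fintype.card ι * (2 * Real.exp (-(η ^ 2 * k / 16))) +
          Fintype.card ι * (2 * Real.exp (-(η ^ 2 * k ^ 2 / (16 * (K * M) * D))))) := by
  classical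
  have hD0 : 0 < D := by rw [hD]; exact_mod_cast Fintype.card_pos
  have hM0 : 0 < M := by rw [hM]; positivity
  have hKM : 0 < (K : ℝ) * M := by positivity
  -- `A`: pixel `p` is drawn too often. `B`: the first stage deviates. `E`: the second stage
  -- deviates although no pixel is drawn too often. The thresholds of `B` and `E` each use half of
  -- the allowed error, and `θ = η / 4` makes the quadratic term of the exponent half of the linear
  -- one.
  let A (p : α) (x : Fin k → α) : Prop := k / D + L ≤
    |∑ i, (if x i = p then (1 : ℝ) else 0) - k * ((∑ q, if q = p then (1 : ℝ) else 0) / D)|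
  let B (l : ι) (x : Fin k → α) : Prop := η * k / 2 ≤
    |∑ i, ∑ q, graphWeight (Φ l) (G l) (x i) q - k * (graphSum (Φ l) (G l) / D)|
  let E (l : ι) (x y : Fin k → α) : Prop := (∀ p, ¬ A p x) ∧ η * k ^ 2 / (2 * D) ≤
    |∑ j, ∑ i, graphWeight (Φ l) (G l) (x i) (y j) -
      k * ((∑ q, ∑ i, graphWeight (Φ l) (G l) (x i) q) / D)|
  have hA : ∀ p, ((univ.filter fun x => A p x).card : ℝ) ≤
      Fintype.card (Fin k → α) * (2 * Real.exp (-L)) := by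
    intro p
    have := card_deviation_le (fun q => if q = p then (1 : ℝ) else 0) k (B := 1) (m := 1 / D)
      (t := k / D + L) (θ := 1) one_pos (fun q => by positivity) (fun q => by split_ifs <;> simp)
      (by rw [← hD, div_mul_cancel₀ _ hD0.ne']; simp) zero_le_one le_rfl
    rw [← hD] at this
    convert this using 4
    ring
  have hB : ∀ l, ((univ.filter fun x => B l x).card : ℝ) ≤
      Fintype.card (Fin k → α) * (2 * Real.exp (-(η ^ 2 * k / 16))) := by
    intro l
    have := card_deviation_le (fun p => ∑ q, graphWeight (Φ l) (G l) p q) k (B := 1) (m := 1)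
      (t := η * k / 2) (θ := η / 4) one_pos
      (fun p => sum_nonneg fun q _ => graphWeight_nonneg (hG0 l) p q)
      (sum_graphWeight_le_one (hG1 l))
      ((sum_le_sum fun p _ => sum_graphWeight_le_one (hG1 l) p).trans_eq (by simp))
      (by positivity) (by linarith)
    rw [← hD] at this
    convert this using 4
    · exact Iff.rfl
    · ring
  have hE : ∀ l x, ((univ.filter fun y => E l x y).card : ℝ) ≤ Fintype.card (Fin k → α) *
      (2 * Real.exp (-(η ^ 2 * k ^ 2 / (16 * (K * M) * D)))) := by
    intro l x
    by_cases hx : ∀ p, ¬ A p x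
    · have hmult : ∀ p, ((univ.filter fun i => x i = p).card : ℝ) ≤ M := by
        intro p
        have h := lt_of_not_ge (hx p)
        rw [abs_lt] at h
        have h2 := h.2
        rw [sum_boole, sum_ite_eq' univ p] at h2
        simp only [mem_univ, if_true] at h2
        rw [hM]
        have e1 : (k : ℝ) * (1 / D) = k / D := by ring
        have e2 : 2 * (k : ℝ) / D = k / D + k / D := by ring
        linarith
      have := card_deviation_le (fun q => ∑ i, graphWeight (Φ l) (G l) (x i) q) k (B := K * M)
        (m := k / D) (t := η * k ^ 2 / (2 * D)) (θ := η / 4) hKM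
        (fun q => sum_nonneg fun i _ => graphWeight_nonneg (hG0 l) _ q)
        (fun q => sum_graphWeight_le (hG1 l) (hK l q) hM0.le hmult)
        (by
          rw [← hD, div_mul_cancel₀ _ hD0.ne', sum_comm]
          exact (sum_le_sum fun i _ => sum_graphWeight_le_one (hG1 l) (x i)).trans_eq (by simp))
        (by positivity) (by linarith)
      rw [← hD] at this
      refine le_trans (Nat.cast_le.2 (card_le_card fun y hy => ?_)) (this.trans_eq ?_)
      · simp only [mem_filter, mem_univ, true_and] at hy ⊢
        exact hy.2
      · congr 3
        field_simp
        ring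
    · rw [filter_false_of_mem fun y _ h => hx h.1]
      simp only [card_empty, Nat.cast_zero]
      positivity
  refine ⟨(univ.biUnion fun p => univ.filter fun z => A p z.1) ∪
    (univ.biUnion fun l => univ.filter fun z => B l z.1) ∪
    (univ.biUnion fun l => univ.filter fun z => E l z.1 z.2), ?_, ?_⟩
  · intro z hz l
    simp only [mem_union, mem_biUnion, mem_filter, mem_univ, true_and, not_or, not_exists] at hz
    obtain ⟨⟨hzA, hzB⟩, hzE⟩ := hz
    have h1 := lt_of_not_ge (hzB l)
    have h2 := lt_of_not_ge fun h => hzE l ⟨hzA, h⟩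
    refine (abs_pairSum_sub_lt hD0 h1 h2).trans_eq ?_
    field_simp
    norm_num
  · set R := (Fintype.card ((Fin k → α) × (Fin k → α)) : ℝ) with hR
    have hR' : R = Fintype.card (Fin k → α) * Fintype.card (Fin k → α) := by
      rw [hR, Fintype.card_prod]; push_cast; rfl
    have b1 : ((univ.biUnion fun p => univ.filter fun z : (Fin k → α) × (Fin k → α) =>
        A p z.1).card : ℝ) ≤ D * (R * (2 * Real.exp (-L))) := by
      refine (Nat.cast_le.2 card_biUnion_le).trans ?_
      push_cast
      refine (sum_le_sum fun p _ => card_filter_fst_le (A p) (hA p)).trans_eq ?_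
      rw [sum_const, card_univ, nsmul_eq_mul, hD]
    have b2 : ((univ.biUnion fun l => univ.filter fun z : (Fin k → α) × (Fin k → α) =>
        B l z.1).card : ℝ) ≤ Fintype.card ι * (R * (2 * Real.exp (-(η ^ 2 * k / 16)))) := by
      refine (Nat.cast_le.2 card_biUnion_le).trans ?_
      push_cast
      refine (sum_le_sum fun l _ => card_filter_fst_le (B l) (hB l)).trans_eq ?_
      rw [sum_const, card_univ, nsmul_eq_mul]
    have b3 : ((univ.biUnion fun l => univ.filter fun z : (Fin k → α) × (Fin k → α) =>
        E l z.1 z.2).card : ℝ) ≤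
        Fintype.card ι * (R * (2 * Real.exp (-(η ^ 2 * k ^ 2 / (16 * (K * M) * D))))) := by
      refine (Nat.cast_le.2 card_biUnion_le).trans ?_
      push_cast
      refine (sum_le_sum fun l _ => card_filter_prod_le (E l) (hE l)).trans_eq ?_
      rw [sum_const, card_univ, nsmul_eq_mul, hR']
      ring
    refine (Nat.cast_le.2 ((card_union_le _ _).trans
      (Nat.add_le_add_right (card_union_le _ _) _))).trans ?_
    push_cast
    linarith

end Pairs

/-! ### From concentration to correctness -/

section Correctness

variable {c : ℝ} {n k : ℕ}

/-- The two kinds of weights of a pair of pixels: the difference of their values, and `1`. -/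
noncomputable def pixelWeight (M₁ M₂ : GrayImage n) (b : Bool) (p q : Pixel n) : ℝ :=
  if b then |(M₁ p : ℝ) - (M₂ q : ℝ)| else 1

theorem pixelWeight_nonneg (M₁ M₂ : GrayImage n) (b : Bool) (p q : Pixel n) :
    0 ≤ pixelWeight M₁ M₂ b p q := by
  unfold pixelWeight
  split_ifs <;> positivity

theorem pixelWeight_le_one (M₁ M₂ : GrayImage n) (b : Bool) (p q : Pixel n) :
    pixelWeight M₁ M₂ b p q ≤ 1 := by
  unfold pixelWeight
  split_ifs
  · rw [abs_le]
    constructor <;> linarith [(M₁ p).2.1, (M₁ p).2.2, (M₂ q).2.1, (M₂ q).2.2]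
  · exact le_rfl

theorem hit_eq_pairSum (T : ImageAffine c) (M₁ M₂ : GrayImage n) (x y : Fin k → Pixel n) :
    (hit T (fun i => (x i, M₁ (x i))) (fun i => (y i, M₂ (y i))) : ℝ) =
      pairSum (T.pixelMap n) (pixelWeight M₁ M₂ false) x y := by
  unfold hit hitPairs pairSum graphWeight pixelWeight
  rw [card_filter, Fintype.sum_prod_type_right]
  push_cast
  simp [pixelMap_eq_some_iff]

theorem sum_hitPairs_eq_pairSum (T : ImageAffine c) (M₁ M₂ : GrayImage n) (x y : Fin k → Pixel n) :
    ∑ z ∈ hitPairs T (fun i => (x i, M₁ (x i))) (fun i => (y i, M₂ (y i))),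
        |(M₁ (x z.1) : ℝ) - (M₂ (y z.2) : ℝ)| =
      pairSum (T.pixelMap n) (pixelWeight M₁ M₂ true) x y := by
  unfold hitPairs pairSum graphWeight pixelWeight
  rw [sum_filter, Fintype.sum_prod_type_right]
  simp [pixelMap_eq_some_iff]

theorem sum_graphWeight_pixelMap (T : ImageAffine c) (g : Pixel n → Pixel n → ℝ) (p : Pixel n) :
    ∑ q, graphWeight (T.pixelMap n) g p q =
      if h : T.apply p.1 ∈ grid n then g p ⟨T.apply p.1, h⟩ else 0 := by
  unfold graphWeight ImageAffine.pixelMap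
  by_cases h : T.apply p.1 ∈ grid n
  · simp [h]
  · simp [h]

theorem graphSum_one (T : ImageAffine c) (M₁ M₂ : GrayImage n) :
    graphSum (T.pixelMap n) (pixelWeight M₁ M₂ false) = (n : ℝ) ^ 2 - T.out n := by
  have h : (T.out n : ℝ) + ∑ p : Pixel n, (if T.apply p.1 ∈ grid n then (1 : ℝ) else 0) =
      (n : ℝ) ^ 2 := by
    have h1 := card_filter_add_card_filter_not (s := (univ : Finset (Pixel n)))
      (fun p => T.apply p.1 ∈ grid n)
    rw [card_univ, card_pixel] at h1
    rw [sum_boole, ImageAffine.out, add_comm]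
    exact_mod_cast h1
  unfold graphSum
  simp only [sum_graphWeight_pixelMap]
  rw [← h]
  simp [pixelWeight]

theorem distT_eq_graphSum (T : ImageAffine c) (M₁ M₂ : GrayImage n) :
    distT T M₁ M₂ =
      (T.out n + graphSum (T.pixelMap n) (pixelWeight M₁ M₂ true)) / (n : ℝ) ^ 2 := by
  unfold distT graphSum
  simp only [sum_graphWeight_pixelMap]
  rw [one_div_mul_eq_div]
  simp [pixelWeight]

theorem graphSum_nonneg (φ : Pixel n → Option (Pixel n)) (M₁ M₂ : GrayImage n) (b : Bool) :
    0 ≤ graphSum φ (pixelWeight M₁ M₂ b) :=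
  sum_nonneg fun p _ => sum_nonneg fun q _ => graphWeight_nonneg (pixelWeight_nonneg M₁ M₂ b) p q

theorem graphWeight_true_le (φ : Pixel n → Option (Pixel n)) (M₁ M₂ : GrayImage n)
    (p q : Pixel n) :
    graphWeight φ (pixelWeight M₁ M₂ true) p q ≤ graphWeight φ (pixelWeight M₁ M₂ false) p q := by
  unfold graphWeight
  split_ifs
  · exact pixelWeight_le_one M₁ M₂ true p q
  · exact le_rfl

theorem distT_nonneg (T : ImageAffine c) (M₁ M₂ : GrayImage n) : 0 ≤ distT T M₁ M₂ := by
  rw [distT_eq_graphSum]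
  have := graphSum_nonneg (T.pixelMap n) M₁ M₂ true
  positivity

theorem distT_le_one [NeZero n] (T : ImageAffine c) (M₁ M₂ : GrayImage n) :
    distT T M₁ M₂ ≤ 1 := by
  have hn : (0 : ℝ) < (n : ℝ) ^ 2 := by have := NeZero.pos n; positivity
  rw [distT_eq_graphSum, div_le_one hn]
  have h1 : graphSum (T.pixelMap n) (pixelWeight M₁ M₂ true) ≤
      graphSum (T.pixelMap n) (pixelWeight M₁ M₂ false) :=
    sum_le_sum fun p _ => sum_le_sum fun q _ => graphWeight_true_le _ M₁ M₂ p q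
  rw [graphSum_one] at h1
  linarith

theorem imageDist_le (T : ImageAffine c) (M₁ M₂ : GrayImage n) :
    imageDist c M₁ M₂ ≤ distT T M₁ M₂ :=
  ciInf_le ⟨0, by rintro _ ⟨T, rfl⟩; exact distT_nonneg T M₁ M₂⟩ T

theorem exists_out_eq_zero (hc : 1 ≤ c) (n : ℕ) : ∃ T : ImageAffine c, T.out n = 0 := by
  refine ⟨⟨1, 0, fun v => ?_⟩, ?_⟩
  · have h : Matrix.toEuclideanLin (1 : Matrix (Fin 2) (Fin 2) ℝ) v = v := by
      simp
    rw [h]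
    exact ⟨div_le_self (norm_nonneg v) hc, le_mul_of_one_le_left (norm_nonneg v) hc⟩
  · unfold ImageAffine.out
    rw [card_eq_zero, filter_eq_empty_iff]
    intro p _
    simp [ImageAffine.apply]

theorem out_eq_of_pixelMap_eq {T T' : ImageAffine c} (h : T.pixelMap n = T'.pixelMap n) :
    (T.out n : ℝ) = T'.out n := by
  -- The images are irrelevant here: the weight `1` already reads `n² - Out` off the pixel map.
  have h1 := graphSum_one (n := n) T (fun _ => 0) fun _ => 0
  have h2 := graphSum_one (n := n) T' (fun _ => 0) fun _ => 0
  rw [h] at h1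
  linarith

/-- Replacing `ρ` by `s₁` in `ρ * (s / s₁)` costs at most `|s₁ - ρ|`, because `s / s₁ ≤ 1`. So the
ratio defining `Bad` is harmless however small the number of hits is, as long as it is positive. -/
theorem abs_mul_div_sub_lt {ρ γ s₁ s η : ℝ} (hs₁ : 0 < s₁) (hs : 0 ≤ s) (hle : s ≤ s₁)
    (h1 : |s₁ - ρ| < η) (h2 : |s - γ| < η) : |ρ * (s / s₁) - γ| < 2 * η := by
  have e : ρ * (s / s₁) - γ = -(s / s₁ * (s₁ - ρ)) + (s - γ) := by
    field_simp
    ring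
  have h3 : |s / s₁ * (s₁ - ρ)| ≤ |s₁ - ρ| := by
    rw [abs_mul, abs_of_nonneg (by positivity)]
    exact mul_le_of_le_one_left (abs_nonneg _) ((div_le_one hs₁).2 hle)
  rw [e]
  refine (abs_add_le _ _).trans_lt ?_
  rw [abs_neg]
  linarith

variable {M₁ M₂ : GrayImage n} {x y : Fin k → Pixel n} {η : ℝ}

theorem abs_normalized_pairSum_sub_lt [NeZero n] (hk : 0 < k) {S F : ℝ}
    (h : |S - k ^ 2 * F / ((n : ℝ) ^ 2) ^ 2| < η * k ^ 2 / (n : ℝ) ^ 2) :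
    |S * ((n : ℝ) ^ 2 / k ^ 2) - F / (n : ℝ) ^ 2| < η := by
  have hn0 : (n : ℝ) ≠ 0 := NeZero.ne _
  have hn : (0 : ℝ) < (n : ℝ) ^ 2 := by positivity
  have hk' : (0 : ℝ) < (k : ℝ) ^ 2 := by positivity
  have e : S * ((n : ℝ) ^ 2 / k ^ 2) - F / (n : ℝ) ^ 2 =
      (S - k ^ 2 * F / ((n : ℝ) ^ 2) ^ 2) * ((n : ℝ) ^ 2 / k ^ 2) := by
    field_simp
  rw [e, abs_mul, abs_of_pos (div_pos hn hk')]
  calc _ < η * k ^ 2 / (n : ℝ) ^ 2 * ((n : ℝ) ^ 2 / k ^ 2) := by gcongr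
    _ = η := by field_simp

theorem abs_score_sub_distT_lt [NeZero n] (hk : 0 < k) (T : ImageAffine c)
    (hhit : 0 < hit T (fun i => (x i, M₁ (x i))) fun i => (y i, M₂ (y i)))
    (h : ∀ b, |pairSum (T.pixelMap n) (pixelWeight M₁ M₂ b) x y -
      k ^ 2 * graphSum (T.pixelMap n) (pixelWeight M₁ M₂ b) / ((n : ℝ) ^ 2) ^ 2| <
        η * k ^ 2 / (n : ℝ) ^ 2) :
    |score T (fun i => (x i, M₁ (x i))) (fun i => (y i, M₂ (y i))) / (n : ℝ) ^ 2 -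
      distT T M₁ M₂| < 2 * η := by
  have hn : (0 : ℝ) < (n : ℝ) ^ 2 := by have := NeZero.pos n; positivity
  have hk' : (0 : ℝ) < (k : ℝ) ^ 2 := by positivity
  have hN := div_pos hn hk'
  have hpos : (0 : ℝ) < pairSum (T.pixelMap n) (pixelWeight M₁ M₂ false) x y := by
    rw [← hit_eq_pairSum]
    exact_mod_cast hhit
  have h0 : 0 ≤ pairSum (T.pixelMap n) (pixelWeight M₁ M₂ true) x y :=
    sum_nonneg fun j _ => sum_nonneg fun i _ => graphWeight_nonneg (pixelWeight_nonneg M₁ M₂ _) _ _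
  have hle : pairSum (T.pixelMap n) (pixelWeight M₁ M₂ true) x y ≤
      pairSum (T.pixelMap n) (pixelWeight M₁ M₂ false) x y :=
    sum_le_sum fun j _ => sum_le_sum fun i _ => graphWeight_true_le _ M₁ M₂ _ _
  have := abs_mul_div_sub_lt (mul_pos hpos hN) (mul_nonneg h0 hN.le)
    (mul_le_mul_of_nonneg_right hle hN.le) (abs_normalized_pairSum_sub_lt hk (h false))
    (abs_normalized_pairSum_sub_lt hk (h true))
  convert this using 2
  rw [score, bad, distT_eq_graphSum, hit_eq_pairSum, sum_hitPairs_eq_pairSum, graphSum_one]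
  field_simp
  ring

theorem hit_pos_of_lt [NeZero n] (hk : 0 < k) (T : ImageAffine c)
    (hT : η * (n : ℝ) ^ 2 ≤ (n : ℝ) ^ 2 - T.out n)
    (h : |pairSum (T.pixelMap n) (pixelWeight M₁ M₂ false) x y -
      k ^ 2 * graphSum (T.pixelMap n) (pixelWeight M₁ M₂ false) / ((n : ℝ) ^ 2) ^ 2| <
        η * k ^ 2 / (n : ℝ) ^ 2) :
    0 < hit T (fun i => (x i, M₁ (x i))) fun i => (y i, M₂ (y i)) := by
  have hn : (0 : ℝ) < (n : ℝ) ^ 2 := by have := NeZero.pos n; positivity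
  have h1 := abs_normalized_pairSum_sub_lt hk h
  rw [graphSum_one, abs_lt] at h1
  have h2 : η ≤ ((n : ℝ) ^ 2 - T.out n) / (n : ℝ) ^ 2 := (le_div_iff₀ hn).2 hT
  have h3 : 0 < pairSum (T.pixelMap n) (pixelWeight M₁ M₂ false) x y *
      ((n : ℝ) ^ 2 / k ^ 2) := by linarith [h1.1]
  have h4 := pos_of_mul_pos_left h3 (by positivity)
  rw [← hit_eq_pairSum] at h4
  exact_mod_cast h4

/-- If the sampled weights are close to their means for every transformation, then the output of
the algorithm is nearly optimal. -/
theorem outcome_of_pairSum [NeZero n] (hc : 1 ≤ c) (hk : 0 < k) {ε : ℝ} (hε0 : 0 < ε)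
    (hε1 : ε ≤ 1) {L : List (ImageAffine c)} (hL : Enumerates n L)
    (h : ∀ (T : ImageAffine c) (b : Bool), |pairSum (T.pixelMap n) (pixelWeight M₁ M₂ b) x y -
      k ^ 2 * graphSum (T.pixelMap n) (pixelWeight M₁ M₂ b) / ((n : ℝ) ^ 2) ^ 2| <
        ε / 5 * k ^ 2 / (n : ℝ) ^ 2) :
    ∃ T : ImageAffine c, outcome ε k L M₁ M₂ (x, y) = some T ∧
      |distT T M₁ M₂ - imageDist c M₁ M₂| < ε := by
  have hn : (0 : ℝ) < (n : ℝ) ^ 2 := by have := NeZero.pos n; positivity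
  obtain ⟨T₀, hT₀L, hT₀hit, hT₀⟩ : ∃ T₀ ∈ L,
      0 < hit T₀ (fun i => (x i, M₁ (x i))) (fun i => (y i, M₂ (y i))) ∧
        distT T₀ M₁ M₂ ≤ imageDist c M₁ M₂ + ε / 5 := by
    obtain ⟨S, hS⟩ := exists_distT_eq_imageDist hc M₁ M₂
    -- With overlap at least `ε / 5`, the optimum is hit. Otherwise its distance exceeds `1 - ε /
    -- 5`, and the identity, which maps no pixel out and has distance at most `1`, is nearly
    -- optimal.
    rcases le_or_gt (ε / 5 * (n : ℝ) ^ 2) ((n : ℝ) ^ 2 - S.out n) with hρ | hρ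
    · obtain ⟨T, hT, hTS⟩ := hL S
      refine ⟨T, hT, hit_pos_of_lt hk T ?_ (h T false), ?_⟩
      · rwa [out_eq_of_pixelMap_eq hTS]
      · rw [distT_eq_of_pixelMap_eq hTS, hS]
        linarith
    · obtain ⟨I, hI⟩ := exists_out_eq_zero hc n
      obtain ⟨T, hT, hTI⟩ := hL I
      refine ⟨T, hT, hit_pos_of_lt hk T ?_ (h T false), ?_⟩
      · rw [out_eq_of_pixelMap_eq hTI, hI]
        push_cast
        nlinarith
      · have h1 : 1 - ε / 5 ≤ distT S M₁ M₂ := by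
          rw [distT_eq_graphSum, le_div_iff₀ hn]
          have := graphSum_nonneg (S.pixelMap n) M₁ M₂ true
          linarith
        linarith [distT_le_one T M₁ M₂]
  set f : ImageAffine c → ℝ :=
    fun T => score T (fun i => (x i, M₁ (x i))) fun i => (y i, M₂ (y i)) with hf
  set L' := L.filter fun T => decide (ε ≤ (hit T (fun i => (x i, M₁ (x i)))
    (fun i => (y i, M₂ (y i))) : ℝ)) with hL'
  have hout : outcome ε k L M₁ M₂ (x, y) = L'.argmin f := rfl
  have hmem : T₀ ∈ L' := by
    rw [hL', List.mem_filter]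
    refine ⟨hT₀L, decide_eq_true ?_⟩
    -- `Hit` is an integer and `ε ≤ 1`, so the test `Hit ≥ ε` only asks for one hit.
    have : (1 : ℝ) ≤ (hit T₀ (fun i => (x i, M₁ (x i))) (fun i => (y i, M₂ (y i))) : ℝ) := by
      exact_mod_cast hT₀hit
    linarith
  rcases hA : L'.argmin f with _ | T
  · rw [List.argmin_eq_none] at hA
    rw [hA] at hmem
    simp at hmem
  · refine ⟨T, hout.trans hA, ?_⟩
    have hT := List.mem_filter.1 (List.argmin_mem (show T ∈ L'.argmin f from hA))
    have hThit : 0 < hit T (fun i => (x i, M₁ (x i))) fun i => (y i, M₂ (y i)) := by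
      have := hε0.trans_le (of_decide_eq_true hT.2)
      exact_mod_cast this
    have hle : f T / (n : ℝ) ^ 2 ≤ f T₀ / (n : ℝ) ^ 2 := by
      have := List.le_of_mem_argmin hmem (show T ∈ L'.argmin f from hA)
      gcongr
    have e1 := abs_lt.1 (abs_score_sub_distT_lt hk T hThit (h T))
    have e2 := abs_lt.1 (abs_score_sub_distT_lt hk T₀ hT₀hit (h T₀))
    have h3 := imageDist_le T M₁ M₂
    rw [abs_of_nonneg (by linarith)]
    -- The error budget: `2ε/5` for each of the two scores and `ε/5` for the choice of `T₀`.
    linarith [e1.1, e2.2]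

end Correctness

/-! ### The sample size -/

/-- The denominator splits the second claim in two: the part `2 * k / n²` of the multiplicity bound
needs `ε² k ≳ K ℓ`, and the part `6 * ℓ` needs `ε k ≳ K n ℓ`. Both follow from `k ≳ K n ℓ / ε²`. -/
theorem sample_size_bounds {n k K : ℕ} (hn : 0 < n) (hK : 0 < K) {ε ℓ : ℝ} (hε0 : 0 < ε)
    (hε1 : ε ≤ 1) (hℓ : 0 < ℓ)
    (hk : 10 ^ 6 * K * ((n : ℝ) / ε ^ 2) * ℓ ≤ k) :
    30 * ℓ ≤ (ε / 5) ^ 2 * k / 16 ∧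
      30 * ℓ ≤ (ε / 5) ^ 2 * k ^ 2 /
        (16 * (K * (2 * k / (n : ℝ) ^ 2 + 6 * ℓ)) * (n : ℝ) ^ 2) := by
  have hn1 : (1 : ℝ) ≤ n := by exact_mod_cast hn
  have hK1 : (1 : ℝ) ≤ K := by exact_mod_cast hK
  have h1 : 10 ^ 6 * (K * n * ℓ) ≤ ε ^ 2 * k := by
    calc 10 ^ 6 * (K * n * ℓ) = ε ^ 2 * (10 ^ 6 * K * ((n : ℝ) / ε ^ 2) * ℓ) := by field_simp
      _ ≤ _ := by gcongr
  have h2 : 10 ^ 6 * (K * n * ℓ) ≤ ε * k := by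
    refine h1.trans ?_
    gcongr
    nlinarith
  have hKℓ : K * ℓ ≤ K * n * ℓ := by
    have : K * ℓ * 1 ≤ K * ℓ * n := by gcongr
    linarith
  have hℓ1 : ℓ ≤ K * ℓ := le_mul_of_one_le_left hℓ.le hK1
  refine ⟨by nlinarith, ?_⟩
  rw [le_div_iff₀ (by positivity)]
  have e : 30 * ℓ * (16 * (K * (2 * k / (n : ℝ) ^ 2 + 6 * ℓ)) * (n : ℝ) ^ 2) =
      480 * (2 * (K * ℓ * k) + 6 * (K * n ^ 2 * ℓ ^ 2)) := by
    field_simp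
    norm_num
  rw [e]
  have h3 : 10 ^ 6 * (K * ℓ) * k ≤ ε ^ 2 * k * k := by
    refine mul_le_mul_of_nonneg_right ?_ (Nat.cast_nonneg k)
    linarith
  have h4 : (10 ^ 6 * (K * n * ℓ)) ^ 2 ≤ (ε * k) ^ 2 := by gcongr
  have h5 : K * (n : ℝ) ^ 2 * ℓ ^ 2 ≤ (K * n * ℓ) ^ 2 := by
    calc K * (n : ℝ) ^ 2 * ℓ ^ 2 ≤ K * (K * (n : ℝ) ^ 2 * ℓ ^ 2) :=
          le_mul_of_one_le_left (by positivity) hK1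
      _ = _ := by ring
  have h6 : 0 ≤ K * (n : ℝ) ^ 2 * ℓ ^ 2 := by positivity
  have h7 : 0 ≤ K * ℓ * (k : ℝ) := by positivity
  nlinarith

/-- With `u = n + 1 ≥ 2`, the exponent `30` beats the `u ^ 24` events by `u ^ 6` and the exponent
`6` beats the `n²` pixels by `u ^ 4`. The total is at most `1/8 + 1/16 + 1/16`. -/
theorem failure_probability_le {n : ℕ} (hn : 0 < n) {I a b : ℝ}
    (hI : I ≤ 2 * ((n : ℝ) + 1) ^ 24) (ha : 30 * Real.log ((n : ℝ) + 1) ≤ a)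
    (hb : 30 * Real.log ((n : ℝ) + 1) ≤ b) :
    (n : ℝ) ^ 2 * (2 * Real.exp (-(6 * Real.log ((n : ℝ) + 1)))) + I * (2 * Real.exp (-a)) +
      I * (2 * Real.exp (-b)) ≤ 1 / 3 := by
  set u : ℝ := (n : ℝ) + 1 with hu
  have hn1 : (1 : ℝ) ≤ n := by exact_mod_cast hn
  have hu2 : 2 ≤ u := by linarith
  have hu0 : 0 < u := by linarith
  have hexp : ∀ m : ℕ, Real.exp (-(m * Real.log u)) = 1 / u ^ m := by
    intro m
    rw [Real.exp_neg, Real.exp_nat_mul, Real.exp_log hu0, one_div]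
  have hsmall : ∀ {a : ℝ}, 30 * Real.log u ≤ a → I * (2 * Real.exp (-a)) ≤ 1 / 16 := by
    intro a ha
    calc I * (2 * Real.exp (-a)) ≤ 2 * u ^ 24 * (2 * Real.exp (-((30 : ℕ) * Real.log u))) := by
          gcongr
          exact_mod_cast ha
      _ = 4 / u ^ 6 := by rw [hexp]; field_simp; norm_num
      _ ≤ 4 / 2 ^ 6 := by gcongr
      _ = 1 / 16 := by norm_num
  have h0 : (n : ℝ) ^ 2 * (2 * Real.exp (-(6 * Real.log u))) ≤ 1 / 8 := by
    calc (n : ℝ) ^ 2 * (2 * Real.exp (-(6 * Real.log u)))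
        ≤ u ^ 2 * (2 * Real.exp (-((6 : ℕ) * Real.log u))) := by
          norm_num only [Nat.cast_ofNat]
          gcongr
          linarith
      _ = 2 / u ^ 4 := by rw [hexp]; field_simp
      _ ≤ 2 / 2 ^ 4 := by gcongr
      _ = 1 / 8 := by norm_num
  linarith [hsmall ha, hsmall hb]

theorem card_pixelMaps_prod_bool_le (n : ℕ) (c : ℝ) :
    (Fintype.card (pixelMaps n c × Bool) : ℝ) ≤ 2 * ((n : ℝ) + 1) ^ 24 := by
  rw [Fintype.card_prod, Fintype.card_coe, Fintype.card_bool, mul_comm]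
  exact_mod_cast Nat.mul_le_mul_left 2 (card_pixelMaps_le n c)

theorem fibreBound_pos (c : ℝ) : 0 < fibreBound c := by
  unfold fibreBound
  positivity

end ImageMatching

theorem mainTheorem1 (c : ℝ) (hc : 1 ≤ c) :
    ∃ (C : ℝ) (a : ℕ), 0 < C ∧
      ∀ (n : ℕ) [NeZero n] (ε : ℝ), 0 < ε → ε ≤ 1 →
      ∀ L : List (ImageMatching.ImageAffine c), ImageMatching.Enumerates n L →
      ∀ M₁ M₂ : ImageMatching.GrayImage n,
        (∀ r ∈ ((ImageMatching.matchAlg n ε (ImageMatching.sampleSize C a n ε) L).run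
            M₁ M₂).support, r.2 = 2 * ImageMatching.sampleSize C a n ε) ∧
        (2 / 3 : ENNReal) ≤
          ((ImageMatching.matchAlg n ε (ImageMatching.sampleSize C a n ε) L).run
            M₁ M₂).toOuterMeasure
            {r | ∃ T : ImageMatching.ImageAffine c, r.1 = some T ∧
              |ImageMatching.distT T M₁ M₂ - ImageMatching.imageDist c M₁ M₂| < ε} := by
  open ImageMatching in
  have hK := fibreBound_pos c
  refine ⟨10 ^ 6 * fibreBound c, 1, by positivity, fun n _ ε hε0 hε1 L hL M₁ M₂ => ?_⟩
  set k := sampleSize (10 ^ 6 * fibreBound c) 1 n ε with hk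
  have hn := NeZero.pos n
  have hℓ : 0 < Real.log ((n : ℝ) + 1) := Real.log_pos (by
    have : (0 : ℝ) < n := by exact_mod_cast hn
    linarith)
  have hkle : 10 ^ 6 * fibreBound c * ((n : ℝ) / ε ^ 2) * Real.log ((n : ℝ) + 1) ≤ k := by
    rw [hk, sampleSize, pow_one]
    exact Nat.le_ceil _
  have hk0 : 0 < k := by
    have : (0 : ℝ) < k := lt_of_lt_of_le (by positivity) hkle
    exact_mod_cast this
  rw [run_matchAlg]
  constructor
  · intro r hr
    rw [PMF.mem_support_map_iff] at hr
    obtain ⟨z, -, rfl⟩ := hr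
    rfl
  -- The union bound runs over induced pixel maps and the two weights, not over `L`, whose length is
  -- arbitrary.
  · obtain ⟨Bad, hBad, hcard⟩ := exists_card_le_of_pairSum
      (fun l : pixelMaps n c × Bool => l.1.1) (fun l => pixelWeight M₁ M₂ l.2)
      (fun l => pixelWeight_nonneg M₁ M₂ l.2) (fun l => pixelWeight_le_one M₁ M₂ l.2) hK
      (by
        rintro ⟨⟨φ, hφ⟩, b⟩ q
        obtain ⟨T, rfl⟩ := mem_pixelMaps.1 hφ
        exact card_fibre_le (by linarith) T q)
      k (η := ε / 5) (L := 6 * Real.log ((n : ℝ) + 1)) (D := (n : ℝ) ^ 2) (by positivity)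
      (by linarith) (by positivity) (by rw [card_pixel]; push_cast; rfl) rfl
    have hb := sample_size_bounds hn hK hε0 hε1 hℓ hkle
    refine le_toOuterMeasure_of_card_le _ _ Bad (fun z hz => ?_) (hcard.trans ?_)
    · exact outcome_of_pairSum hc hk0 hε0 hε1 hL fun T b =>
        hBad z hz (⟨T.pixelMap n, mem_pixelMaps.2 ⟨T, rfl⟩⟩, b)
    · rw [mul_comm]
      gcongr
      exact failure_probability_le hn (card_pixelMaps_prod_bool_le n c)
        hb.1 hb.2
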